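/- Let $d\ge 0$ and let $\mathbb{R}^d$ carry the Euclidean inner product and norm. A family $\{S_t\}_{t\in[a,b]}$ of subsets of $\mathbb{R}^d$, indexed by a compact interval $[a,b]\subset\mathbb{R}$ with $a\le b$, is called a *convex foliation* if (1) every $S_t$ is nonempty, closed and convex; (2) $S_{t_1}\subset\operatorname{int}S_{t_2}$ whenever $t_1<t_2$; and (3) $\bigcup_{t\in[a,b]}\partial S_t=S_b\setminus\operatorname{int}S_a$. For $x\in S_b\setminus\operatorname{int}S_a$ let $S_x$ denote the unique set of the foliation with $x\in\partial S_x$. For a convex set $Q$ and $x\in Q$ let $N_Q(x)=\{v\in\mathbb{R}^d:\langle v,y-x\rangle\le 0\text{ for all }y\in Q\}$ be the normal cone. **Theorem.** Let $\{S_t\}_{t\in[a,b]}$ be a convex foliation. Then for every $x_0\in S_b$ there are $L\ge 0$ and an absolutely continuous curve $\gamma:[0,L]\to\mathbb{R}^d$ with $\gamma(0)=x_0$ and $\gamma(L)\in S_a$ such that - $\gamma$ is self-contracted: for every $t^*\in[0,L]$ the function $t\mapsto\|\gamma(t)-\gamma(t^*)\|$ is nonincreasing on $[0,t^*]$; - $\gamma$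 is a trajectory of the foliation: for almost every $\tau\in[0,L]$ the derivative $\dot\gamma(\tau)$ exists and $\dot\gamma(\tau)\in-N_{S_{\gamma(\tau)}}(\gamma(\tau))$, and for all $\tau_1<\tau_2$ in $[0,L]$ one has $\gamma(\tau_2)\in\operatorname{int}S_{\gamma(\tau_1)}$. Here the set $S_{\gamma(\tau)}$ is defined, that is, $\gamma(\tau)\in S_b\setminus\operatorname{int}S_a$, wherever it is mentioned. (If $L=0$, both trajectory conditions are vacuous; this is the situation when $x_0\in\operatorname{int}S_a$.) -/

import Mathlib

open Set MeasureTheory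

/-- A convex foliation `{S_t}_{t ∈ [a,b]}`. The family is given as a function on `ℝ`, of which only
the values on the interval `[a, b]` matter. -/
structure IsConvexFoliation {E : Type*} [NormedAddCommGroup E] [InnerProductSpace ℝ E]
    (S : ℝ → Set E) (a b : ℝ) : Prop where
  le : a ≤ b
  nonempty : ∀ t ∈ Icc a b, (S t).Nonempty
  isClosed : ∀ t ∈ Icc a b, IsClosed (S t)
  convex : ∀ t ∈ Icc a b, Convex ℝ (S t)
  subset_interior : ∀ t₁ ∈ Icc a b, ∀ t₂ ∈ Icc a b, t₁ < t₂ → S t₁ ⊆ interior (S t₂)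
  iUnion_frontier : ⋃ t ∈ Icc a b, frontier (S t) = S b \ interior (S a)

/-- `Q` is the set `S_x` of the foliation, i.e. a set of the foliation with `x ∈ ∂Q`. -/
def IsLeafAt {E : Type*} [NormedAddCommGroup E] [InnerProductSpace ℝ E]
    (S : ℝ → Set E) (a b : ℝ) (x : E) (Q : Set E) : Prop :=
  ∃ t ∈ Icc a b, Q = S t ∧ x ∈ frontier (S t)

/-- The set `S_x` exists and is unique for every `x ∈ S_b \ int S_a`. -/
theorem IsConvexFoliation.existsUnique_isLeafAt {E : Type*} [NormedAddCommGroup E]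
    [InnerProductSpace ℝ E] {S : ℝ → Set E} {a b : ℝ} (hS : IsConvexFoliation S a b)
    {x : E} (hx : x ∈ S b \ interior (S a)) : ∃! Q : Set E, IsLeafAt S a b x Q := by
  rw [← hS.iUnion_frontier] at hx
  simp only [mem_iUnion, exists_prop] at hx
  obtain ⟨t, ht, hxt⟩ := hx
  have key : ∀ r ∈ Icc a b, ∀ s ∈ Icc a b, x ∈ frontier (S r) → x ∈ frontier (S s) → ¬ r < s :=
    fun r hr s hs hxr hxs hrs =>
      hxs.2 (hS.subset_interior r hr s hs hrs ((hS.isClosed r hr).frontier_subset hxr))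
  refine ⟨S t, ⟨t, ht, rfl, hxt⟩, ?_⟩
  rintro Q ⟨s, hs, rfl, hxs⟩
  rw [le_antisymm (not_lt.1 (key t ht s hs hxt hxs)) (not_lt.1 (key s hs t ht hxs hxt))]

/-- The normal cone `N_Q(x)` of a convex set `Q` at a point `x ∈ Q`. -/
def normalCone {E : Type*} [NormedAddCommGroup E] [InnerProductSpace ℝ E]
    (Q : Set E) (x : E) : Set E :=
  {v | ∀ y ∈ Q, inner ℝ v (y - x) ≤ 0}

/-- The curve `γ : I → E` is self-contracted. -/
def IsSelfContractedOn {E : Type*} [NormedAddCommGroup E] [InnerProductSpace ℝ E]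
    (γ : ℝ → E) (I : Set ℝ) : Prop :=
  ∀ s ∈ I, AntitoneOn (fun t => dist (γ t) (γ s)) (I ∩ Iic s)

/-- The curve `γ : [α, β] → E` is an absolutely continuous parametrization of a trajectory of the
foliation: for almost every `τ` the derivative exists and lies in `-N_{S_{γ(τ)}}(γ(τ))`, and
`γ(τ₂) ∈ int S_{γ(τ₁)}` whenever `τ₁ < τ₂`. Both conditions include that the set `S_{γ(τ)}` is
defined at the points where it is mentioned. -/
structure IsTrajectoryOn {E : Type*} [NormedAddCommGroup E] [InnerProductSpace ℝ E]
    (S : ℝ → Set E) (a b : ℝ) (γ : ℝ → E) (α β : ℝ) : Prop where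
  absolutelyContinuous : AbsolutelyContinuousOnInterval γ α β
  deriv_mem : ∀ᵐ τ ∂(volume.restrict (Icc α β)), ∃ (Q : Set E) (v : E),
    IsLeafAt S a b (γ τ) Q ∧ HasDerivWithinAt γ v (Icc α β) τ ∧ -v ∈ normalCone Q (γ τ)
  mem_interior : ∀ τ₁ ∈ Icc α β, ∀ τ₂ ∈ Icc α β, τ₁ < τ₂ →
    ∃ Q : Set E, IsLeafAt S a b (γ τ₁) Q ∧ γ τ₂ ∈ interior Q

/-!
The curve is first built as a function `x` of the level `t`, running from the level `t₀` of `x₀`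
down to `a`. On finitely many levels one takes iterated metric projections; each of them does not
increase the distance to any point of the set projected onto (Fejér monotonicity), and it lands on
the boundary of that set. Both properties are pointwise closed conditions, so an ultrafilter limit
over all finite sets of levels gives a Fejér monotone selection `x t ∈ ∂(S t)` on all of `[a, t₀]`
(`IsConvexFoliation.exists_isFejerSelection`). Everything else follows from Fejér monotonicity:

* Self-contractedness is the special case in which the distance is measured to a later point of
  the curve.
* There are no jumps (`IsConvexFoliation.continuousOn_of_isFejerSelection`). Since the boundaries
  fill `S b \ int (S a)`, the foliation is continuous in `t`, so both ends of a jump at the level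
  `t` would lie in `S t`, and Fejér monotonicity with one of these ends as reference point makes
  them coincide.
* The curve has finite length (`exists_continuousOn_dist_le`). The vectors from one point of the
  curve to the later ones have pairwise nonnegative inner products, so they make a definite angle
  with one of finitely many directions (`exists_finset_forall_exists_norm_le_inner`), and the
  extent of the remaining curve in that direction shrinks at least proportionally to the distance
  travelled. The sum of these extents is a continuous parameter in which the curve is Lipschitz,
  hence absolutely continuous and almost everywhere differentiable.
* The velocity lies in the opposite normal cone (`inner_hasDerivWithinAt_nonneg`), because the
  distance to every `y ∈ int (S t)`, which is a point of some strictly earlier set, does not increase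
  for a while after the curve has passed level `t`; such `y` are dense in `S t`.
-/

open Filter Topology

/-! ### Levels of a convex foliation -/

section Foliation

variable {E : Type*} [NormedAddCommGroup E] [InnerProductSpace ℝ E] {S : ℝ → Set E} {a b : ℝ}

theorem IsConvexFoliation.mono (hS : IsConvexFoliation S a b) {s t : ℝ} (hs : s ∈ Icc a b)
    (ht : t ∈ Icc a b) (hst : s ≤ t) : S s ⊆ S t := by
  rcases hst.eq_or_lt with rfl | h
  · exact subset_rfl
  · exact (hS.subset_interior s hs t ht h).trans interior_subset

theorem IsConvexFoliation.frontier_subset (hS : IsConvexFoliation S a b) {t : ℝ}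
    (ht : t ∈ Icc a b) : frontier (S t) ⊆ S t :=
  (hS.isClosed t ht).frontier_subset

theorem IsConvexFoliation.exists_mem_frontier (hS : IsConvexFoliation S a b) {x : E}
    (hx : x ∈ S b) (hxa : x ∉ interior (S a)) : ∃ t ∈ Icc a b, x ∈ frontier (S t) := by
  have h : x ∈ S b \ interior (S a) := ⟨hx, hxa⟩
  rw [← hS.iUnion_frontier] at h
  simpa only [mem_iUnion, exists_prop] using h

/-- Left continuity of the foliation: the interior of `S t` is the union of the earlier sets. -/
theorem IsConvexFoliation.exists_lt_mem (hS : IsConvexFoliation S a b) {t : ℝ}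
    (ht : t ∈ Icc a b) (hat : a < t) {z : E} (hz : z ∈ interior (S t)) :
    ∃ s ∈ Ico a t, z ∈ S s := by
  have ha : a ∈ Icc a b := left_mem_Icc.2 hS.le
  by_cases hza : z ∈ interior (S a)
  · exact ⟨a, ⟨le_rfl, hat⟩, interior_subset hza⟩
  obtain ⟨s, hs, hzs⟩ := hS.exists_mem_frontier
    (hS.mono ht (right_mem_Icc.2 hS.le) ht.2 (interior_subset hz)) hza
  refine ⟨s, ⟨hs.1, not_le.1 fun hts => ?_⟩, hS.frontier_subset hs hzs⟩
  rcases hts.eq_or_lt with rfl | h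
  · exact hzs.2 hz
  · exact hzs.2 (hS.subset_interior t ht s hs h (interior_subset hz))

/-- Right continuity of the foliation: `S t` is the intersection of the later sets. -/
theorem IsConvexFoliation.mem_of_forall_gt (hS : IsConvexFoliation S a b) {t : ℝ}
    (ht : t ∈ Icc a b) (htb : t < b) {p : E} (hp : ∀ s ∈ Ioc t b, p ∈ S s) : p ∈ S t := by
  have ha : a ∈ Icc a b := left_mem_Icc.2 hS.le
  by_cases hpa : p ∈ interior (S a)
  · exact hS.mono ha ht ht.1 (interior_subset hpa)
  obtain ⟨r, hr, hpr⟩ := hS.exists_mem_frontier (hp b ⟨htb, le_rfl⟩) hpa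
  rcases le_or_gt r t with hrt | htr
  · exact hS.mono hr ht hrt (hS.frontier_subset hr hpr)
  · obtain ⟨s, hts, hsr⟩ := exists_between htr
    have hsb : s ≤ b := hsr.le.trans hr.2
    exact absurd (hS.subset_interior s ⟨ht.1.trans hts.le, hsb⟩ r hr hsr (hp s ⟨hts, hsb⟩)) hpr.2

theorem IsConvexFoliation.subset_closure_interior (hS : IsConvexFoliation S a b) {t : ℝ}
    (ht : t ∈ Icc a b) (hat : a < t) : S t ⊆ closure (interior (S t)) := by
  have ha : a ∈ Icc a b := left_mem_Icc.2 hS.le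
  rw [(hS.convex t ht).closure_interior_eq_closure_of_nonempty_interior
    ((hS.nonempty a ha).mono (hS.subset_interior a ha t ht hat))]
  exact subset_closure

/-- The points that occur strictly before level `t` are dense in `S t`. -/
theorem IsConvexFoliation.exists_lt_mem_dist_lt (hS : IsConvexFoliation S a b) {t : ℝ}
    (ht : t ∈ Icc a b) (hat : a < t) {z : E} (hz : z ∈ S t) {ε : ℝ} (hε : 0 < ε) :
    ∃ s ∈ Ico a t, ∃ y ∈ S s, dist z y < ε := by
  obtain ⟨y, hy, hzy⟩ := Metric.mem_closure_iff.1 (hS.subset_closure_interior ht hat hz) ε hε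
  obtain ⟨s, hs, hys⟩ := hS.exists_lt_mem ht hat hy
  exact ⟨s, hs, y, hys, hzy⟩

end Foliation

/-! ### Metric projection onto a convex set -/

/-- A point outside the interior of a closed convex set `K` has a point of `∂K`, namely its metric
projection, that is at least as close to every point of `K`. -/
theorem exists_mem_frontier_forall_dist_le {E : Type*} [NormedAddCommGroup E]
    [InnerProductSpace ℝ E] [CompleteSpace E] {K : Set E} (hne : K.Nonempty) (hcl : IsClosed K)
    (hco : Convex ℝ K) {u : E} (hu : u ∉ interior K) :
    ∃ p ∈ frontier K, ∀ y ∈ K, dist p y ≤ dist u y := by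
  obtain ⟨p, hpK, hp⟩ := exists_norm_eq_iInf_of_complete_convex hne hcl.isComplete hco u
  rw [norm_eq_iInf_iff_real_inner_le_zero hco hpK] at hp
  refine ⟨p, ⟨subset_closure hpK, fun hpi => ?_⟩, fun y hy => ?_⟩
  · have hev : ∀ᶠ ε : ℝ in 𝓝[>] 0, p + ε • (u - p) ∈ K := by
      have hc : Tendsto (fun ε : ℝ => p + ε • (u - p)) (𝓝[>] 0) (𝓝 p) := by
        have : Continuous fun ε : ℝ => p + ε • (u - p) := by fun_prop
        simpa using (this.tendsto 0).mono_left nhdsWithin_le_nhds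
      exact hc (mem_interior_iff_mem_nhds.1 hpi)
    obtain ⟨ε, hεK, hε⟩ := (hev.and self_mem_nhdsWithin).exists
    have h1 := hp _ hεK
    rw [add_sub_cancel_left, inner_smul_right, real_inner_self_eq_norm_sq] at h1
    have h2 : ‖u - p‖ = 0 := by
      have : ‖u - p‖ ^ 2 ≤ 0 := nonpos_of_mul_nonpos_right h1 hε
      exact pow_eq_zero_iff two_ne_zero |>.1 (le_antisymm this (sq_nonneg _))
    rw [norm_sub_eq_zero_iff] at h2
    exact hu (h2 ▸ hpi)
  · rw [dist_eq_norm, dist_eq_norm]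
    refine le_of_sq_le_sq ?_ (norm_nonneg _)
    have h1 := hp y hy
    have h2 : u - y = (u - p) - (y - p) := by abel
    rw [h2, norm_sub_sq_real (u - p), norm_sub_rev p y]
    nlinarith [sq_nonneg ‖u - p‖]

/-! ### Fejér monotone selections of the leaves -/

/-- A choice `x t ∈ ∂(S t)`, for the levels `t ∈ T`, which is Fejér monotone as the level decreases:
passing from the level `t'` to a lower level `t` does not increase the distance to any point
of `S t`. -/
structure IsFejerSelection {E : Type*} [NormedAddCommGroup E] (S : ℝ → Set E) (T : Set ℝ)
    (x : ℝ → E) : Prop where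
  mem_frontier : ∀ t ∈ T, x t ∈ frontier (S t)
  dist_le : ∀ t ∈ T, ∀ t' ∈ T, t ≤ t' → ∀ y ∈ S t, dist (x t) y ≤ dist (x t') y

section Selection

variable {E : Type*} [NormedAddCommGroup E] [InnerProductSpace ℝ E] {S : ℝ → Set E} {a b : ℝ}

/-- On finitely many levels, iterated metric projections give a Fejér monotone selection. -/
theorem IsConvexFoliation.exists_isFejerSelection_finset [CompleteSpace E]
    (hS : IsConvexFoliation S a b) {t₀ : ℝ} (ht₀ : t₀ ∈ Icc a b) {x₀ : E}
    (hx₀ : x₀ ∈ frontier (S t₀)) (F : Finset ℝ) (hF : ∀ t ∈ F, t ∈ Icc a t₀) :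
    ∃ x : ℝ → E, x t₀ = x₀ ∧ IsFejerSelection S (insert t₀ F : Finset ℝ) x := by
  induction F using Finset.induction_on_min with
  | empty =>
    refine ⟨fun _ => x₀, rfl, ?_, ?_⟩
    · simpa using hx₀
    · simp
  | insert m F hm ih =>
    obtain ⟨x, hx, hsel⟩ := ih fun t ht => hF t (Finset.mem_insert_of_mem ht)
    by_cases hmF : m ∈ insert t₀ F
    · refine ⟨x, hx, ?_⟩
      rwa [Finset.insert_comm, Finset.insert_eq_of_mem hmF]
    have hmI := hF m (Finset.mem_insert_self m F)
    have hmb : m ∈ Icc a b := ⟨hmI.1, hmI.2.trans ht₀.2⟩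
    have hlt : ∀ t ∈ insert t₀ F, m < t := by
      intro t ht
      rcases Finset.mem_insert.1 ht with rfl | h
      · exact hmI.2.lt_of_ne fun h => hmF (by simp [h])
      · exact hm t h
    have hsub : ∀ t ∈ insert t₀ F, t ∈ Icc a b := by
      intro t ht
      rcases Finset.mem_insert.1 ht with rfl | h
      · exact ht₀
      · have := hF t (Finset.mem_insert_of_mem h)
        exact ⟨this.1, this.2.trans ht₀.2⟩
    obtain ⟨l, hl, hmin⟩ := Finset.exists_min_image (insert t₀ F) id ⟨t₀, by simp⟩
    have hxl : x l ∉ interior (S m) := fun h => (hsel.mem_frontier l hl).2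
      (hS.subset_interior m hmb l (hsub l hl) (hlt l hl) (interior_subset h))
    obtain ⟨p, hp, hpd⟩ := exists_mem_frontier_forall_dist_le (hS.nonempty m hmb)
      (hS.isClosed m hmb) (hS.convex m hmb) hxl
    have hne : ∀ t ∈ insert t₀ F, Function.update x m p t = x t := fun t ht =>
      Function.update_of_ne (hlt t ht).ne' _ _
    refine ⟨Function.update x m p, (hne t₀ (by simp)).trans hx, ?_⟩
    rw [Finset.insert_comm]
    constructor
    · intro t ht
      rcases Finset.mem_insert.1 (Finset.mem_coe.1 ht) with rfl | h
      · simpa using hp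
      · rw [hne t h]
        exact hsel.mem_frontier t h
    · intro t ht t' ht' htt y hy
      rcases Finset.mem_insert.1 (Finset.mem_coe.1 ht') with rfl | h'
      · rcases Finset.mem_insert.1 (Finset.mem_coe.1 ht) with rfl | h
        · exact le_rfl
        · exact absurd (hlt t h) (not_lt.2 htt)
      · rw [hne t' h']
        rcases Finset.mem_insert.1 (Finset.mem_coe.1 ht) with rfl | h
        · rw [Function.update_self]
          exact (hpd y hy).trans (hsel.dist_le l hl t' h' (hmin t' h') y
            (hS.mono hmb (hsub l hl) (hlt l hl).le hy))
        · rw [hne t h]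
          exact hsel.dist_le t h t' h' htt y hy

/-- Selections on finite sets of levels converge, along an ultrafilter, to one on all levels. -/
theorem IsConvexFoliation.exists_isFejerSelection [ProperSpace E]
    (hS : IsConvexFoliation S a b) {t₀ : ℝ} (ht₀ : t₀ ∈ Icc a b) {x₀ : E}
    (hx₀ : x₀ ∈ frontier (S t₀)) :
    ∃ x : ℝ → E, x t₀ = x₀ ∧ IsFejerSelection S (Icc a t₀) x := by
  classical
  obtain ⟨y₀, hy₀⟩ := hS.nonempty a (left_mem_Icc.2 hS.le)
  have hsub : Icc a t₀ ⊆ Icc a b := Icc_subset_Icc_right ht₀.2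
  choose X hX0 hX using fun F : Finset ℝ => hS.exists_isFejerSelection_finset ht₀ hx₀
    (F.filter (· ∈ Icc a t₀)) (fun t ht => (Finset.mem_filter.1 ht).2)
  let U : Ultrafilter (Finset ℝ) := Ultrafilter.of atTop
  have hU : ∀ t ∈ Icc a t₀, ∀ᶠ F in (U : Filter (Finset ℝ)),
      t ∈ (insert t₀ (F.filter (· ∈ Icc a t₀)) : Finset ℝ) := by
    intro t ht
    refine Ultrafilter.of_le atTop ?_
    filter_upwards [eventually_ge_atTop {t}] with F hF
    exact Finset.mem_insert_of_mem (Finset.mem_filter.2 ⟨hF (Finset.mem_singleton_self t), ht⟩)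
  have hlim : ∀ t ∈ Icc a t₀, ∃ p, Tendsto (fun F => X F t) U (𝓝 p) := by
    intro t ht
    have hball : ∀ᶠ F in (U : Filter (Finset ℝ)), X F t ∈ Metric.closedBall y₀ (dist x₀ y₀) := by
      filter_upwards [hU t ht] with F hF
      rw [Metric.mem_closedBall, ← hX0 F]
      exact (hX F).dist_le t hF t₀ (by simp) ht.2 y₀
        (hS.mono (left_mem_Icc.2 hS.le) (hsub ht) ht.1 hy₀)
    obtain ⟨p, -, hp⟩ := (isCompact_closedBall y₀ (dist x₀ y₀)).ultrafilter_le_nhds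
      (U.map fun F => X F t) (le_principal_iff.2 hball)
    exact ⟨p, hp⟩
  choose! x hx using hlim
  refine ⟨x, ?_, ?_, ?_⟩
  · refine tendsto_nhds_unique (hx t₀ (right_mem_Icc.2 ht₀.1)) ?_
    simp only [hX0]
    exact tendsto_const_nhds
  · intro t ht
    refine isClosed_frontier.mem_of_tendsto (hx t ht) ?_
    filter_upwards [hU t ht] with F hF using (hX F).mem_frontier t hF
  · intro t ht t' ht' htt y hy
    refine le_of_tendsto_of_tendsto ((hx t ht).dist tendsto_const_nhds)
      ((hx t' ht').dist tendsto_const_nhds) ?_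
    filter_upwards [hU t ht, hU t' ht'] with F hF hF'
    exact (hX F).dist_le t hF t' hF' htt y hy

/-- A Fejér monotone selection cannot jump: both ends of a jump at the level `t` would be points
of `S t`, and one of them would have distance zero to the other. -/
theorem IsConvexFoliation.continuousOn_of_isFejerSelection [ProperSpace E]
    (hS : IsConvexFoliation S a b) {t₀ : ℝ} (ht₀ : t₀ ∈ Icc a b) {x : ℝ → E}
    (hx : IsFejerSelection S (Icc a t₀) x) : ContinuousOn x (Icc a t₀) := by
  have hsub : Icc a t₀ ⊆ Icc a b := Icc_subset_Icc_right ht₀.2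
  have hmem : ∀ t ∈ Icc a t₀, x t ∈ S t := fun t ht =>
    hS.frontier_subset (hsub ht) (hx.mem_frontier t ht)
  intro t ht
  have hleft : ContinuousWithinAt x (Icc a t) t := by
    rcases ht.1.eq_or_lt with rfl | hat
    · simp
    rw [Metric.continuousWithinAt_iff']
    intro ε hε
    obtain ⟨s, hs, y, hy, hxy⟩ := hS.exists_lt_mem_dist_lt (hsub ht) hat (hmem t ht) (half_pos hε)
    filter_upwards [self_mem_nhdsWithin, mem_nhdsWithin_of_mem_nhds (lt_mem_nhds hs.2)]
      with r hr hsr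
    have hrI : r ∈ Icc a t₀ := ⟨hr.1, hr.2.trans ht.2⟩
    have h1 := hx.dist_le r hrI t ht hr.2 y
      (hS.mono ⟨hs.1, hs.2.le.trans (hsub ht).2⟩ (hsub hrI) (le_of_lt hsr) hy)
    have h2 := dist_triangle_right (x r) (x t) y
    linarith
  have hright : ContinuousWithinAt x (Icc t t₀) t := by
    rcases ht.2.eq_or_lt with rfl | htt
    · simp
    obtain ⟨y₀, hy₀⟩ := hS.nonempty a (left_mem_Icc.2 hS.le)
    have hball : ∀ s ∈ Icc t t₀, x s ∈ Metric.closedBall y₀ (dist (x t₀) y₀) := fun s hs =>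
      hx.dist_le s ⟨ht.1.trans hs.1, hs.2⟩ t₀ (right_mem_Icc.2 (ht.1.trans ht.2)) hs.2 y₀
        (hS.mono (left_mem_Icc.2 hS.le) (hsub ⟨ht.1.trans hs.1, hs.2⟩) (ht.1.trans hs.1) hy₀)
    refine (isCompact_closedBall y₀ (dist (x t₀) y₀)).le_nhds_of_unique_clusterPt
      (mem_map.2 (mem_of_superset self_mem_nhdsWithin hball)) fun p _ hp => ?_
    have hpt : p ∈ S t := by
      refine hS.mem_of_forall_gt (hsub ht) (htt.trans_le ht₀.2) fun s hs => ?_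
      refine (hS.isClosed s ⟨ht.1.trans hs.1.le, hs.2⟩).closure_subset ?_
      refine mem_closure_iff_clusterPt.2 (hp.mono (le_principal_iff.2 (mem_map.2 ?_)))
      filter_upwards [self_mem_nhdsWithin, mem_nhdsWithin_of_mem_nhds (gt_mem_nhds hs.1)]
        with r hr hrs
      have hrI : r ∈ Icc a t₀ := ⟨ht.1.trans hr.1, hr.2⟩
      exact hS.mono (hsub hrI) ⟨ht.1.trans hs.1.le, hs.2⟩ (le_of_lt hrs) (hmem r hrI)
    have hcl : IsClosed {q : E | dist (x t) p ≤ dist q p} :=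
      isClosed_le continuous_const (continuous_id.dist continuous_const)
    have hpm : p ∈ {q : E | dist (x t) p ≤ dist q p} := by
      refine hcl.closure_subset (mem_closure_iff_clusterPt.2
        (hp.mono (le_principal_iff.2 (mem_map.2 ?_))))
      filter_upwards [self_mem_nhdsWithin] with r hr
      exact hx.dist_le t ht r ⟨ht.1.trans hr.1, hr.2⟩ hr.1 p hpt
    simp only [mem_ofPred_eq, dist_self] at hpm
    exact (dist_le_zero.1 hpm).symm
  rw [← Icc_union_Icc_eq_Icc ht.1 ht.2]
  exact hleft.union hright

end Selection

/-! ### Cones with a definite margin -/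

/-- In a finite-dimensional space finitely many directions suffice to see every family of vectors
with pairwise nonnegative inner products at a definite angle. Up to small perturbations, such a
direction is the sum of boundedly many unit vectors of the family that form a net among its
directions. -/
theorem exists_finset_forall_exists_norm_le_inner (E : Type*) [NormedAddCommGroup E]
    [InnerProductSpace ℝ E] [ProperSpace E] :
    ∃ Z : Finset E, ∀ V : Set E, (∀ v ∈ V, ∀ w ∈ V, 0 ≤ inner ℝ v w) →
      ∃ ζ ∈ Z, ∀ v ∈ V, ‖v‖ ≤ 4 * inner ℝ ζ v := by
  classical
  obtain ⟨N, -, hNfin, hN⟩ := (isCompact_sphere (0 : E) 1).finite_cover_balls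
    (show (0 : ℝ) < 1 / 4 by norm_num)
  obtain ⟨Z, -, hZfin, hZ⟩ := (isCompact_closedBall (0 : E) hNfin.toFinset.card).finite_cover_balls
    (show (0 : ℝ) < 1 / 4 by norm_num)
  refine ⟨hZfin.toFinset, fun V hV => ?_⟩
  let A := hNfin.toFinset.filter fun n => ∃ v ∈ V, v ≠ 0 ∧ dist (‖v‖⁻¹ • v) n < 1 / 4
  have hA : ∀ n ∈ A, ∃ v ∈ V, v ≠ 0 ∧ dist (‖v‖⁻¹ • v) n < 1 / 4 := fun n hn =>
    (Finset.mem_filter.1 hn).2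
  have hunit : ∀ v : E, v ≠ 0 → ‖‖v‖⁻¹ • v‖ = 1 := fun v hv => by
    rw [norm_smul, norm_inv, norm_norm, inv_mul_cancel₀ (norm_ne_zero_iff.2 hv)]
  choose! f hfV hf0 hfd using hA
  have hnorm : ‖∑ n ∈ A, ‖f n‖⁻¹ • f n‖ ≤ hNfin.toFinset.card := by
    refine (norm_sum_le_of_le A fun n hn => (hunit _ (hf0 n hn)).le).trans ?_
    simpa using Finset.card_filter_le hNfin.toFinset _
  obtain ⟨ζ, hζ, hζd⟩ := mem_iUnion₂.1 (hZ (mem_closedBall_zero_iff.2 hnorm))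
  refine ⟨ζ, hZfin.mem_toFinset.2 hζ, fun v hv => ?_⟩
  rcases eq_or_ne v 0 with rfl | hv0
  · simp
  obtain ⟨n, hn, hnd⟩ := mem_iUnion₂.1 (hN (mem_sphere_zero_iff_norm.2 (hunit v hv0)))
  have hnA : n ∈ A := Finset.mem_filter.2 ⟨hNfin.mem_toFinset.2 hn, v, hv, hv0, hnd⟩
  have hclose : ∀ u w : E, inner ℝ u v - dist u w * ‖v‖ ≤ inner ℝ w v := by
    intro u w
    have h := real_inner_le_norm (u - w) v
    rw [inner_sub_left, ← dist_eq_norm] at h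
    linarith
  have hpos : ∀ n ∈ A, 0 ≤ inner ℝ (‖f n‖⁻¹ • f n) v := fun n hn => by
    rw [real_inner_smul_left]
    exact mul_nonneg (inv_nonneg.2 (norm_nonneg _)) (hV _ (hfV n hn) _ hv)
  have h1 : inner ℝ (‖f n‖⁻¹ • f n) v ≤ inner ℝ (∑ n ∈ A, ‖f n‖⁻¹ • f n) v := by
    rw [sum_inner]
    exact Finset.single_le_sum (f := fun n => inner ℝ (‖f n‖⁻¹ • f n) v) hpos hnA
  have h2 : inner ℝ (‖v‖⁻¹ • v) v = ‖v‖ := by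
    rw [real_inner_smul_left, real_inner_self_eq_norm_sq, sq, ← mul_assoc,
      inv_mul_cancel₀ (norm_ne_zero_iff.2 hv0), one_mul]
  have h3 : dist (‖v‖⁻¹ • v) (‖f n‖⁻¹ • f n) ≤ 1 / 4 + 1 / 4 :=
    (dist_triangle_right _ _ n).trans (add_le_add hnd.le (hfd n hnA).le)
  have h4 := hclose (‖v‖⁻¹ • v) (‖f n‖⁻¹ • f n)
  have h5 := hclose (∑ n ∈ A, ‖f n‖⁻¹ • f n) ζ
  have h6 := mul_le_mul_of_nonneg_right h3 (norm_nonneg v)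
  have h7 := mul_le_mul_of_nonneg_right (Metric.mem_ball.1 hζd).le (norm_nonneg v)
  linarith

/-! ### A parameter in which the selection is Lipschitz -/

/-- The running maximum over `[a, t]` of a continuous function is continuous in `t`. -/
theorem continuousOn_sSup_image_Icc {g : ℝ → ℝ} {a c : ℝ} (hg : ContinuousOn g (Icc a c)) :
    ContinuousOn (fun t => sSup (g '' Icc a t)) (Icc a c) := by
  rcases lt_or_ge c a with hca | hac
  · simp [Icc_eq_empty_of_lt hca]
  have hG : Continuous (IccExtend hac ((Icc a c).domRestrict g)) :=
    (continuousOn_iff_continuous_domRestrict.1 hg).Icc_extend'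
  have h := isCompact_Icc.continuous_sSup (K := Icc (0 : ℝ) 1)
    (f := fun t u => IccExtend hac ((Icc a c).domRestrict g) (a + (t - a) * u))
    (hG.comp (by fun_prop : Continuous fun p : ℝ × ℝ => a + (p.1 - a) * p.2))
  refine h.continuousOn.congr fun t ht => ?_
  have hlin : (fun u => a + (t - a) * u) '' Icc (0 : ℝ) 1 = Icc a t := by
    rw [← image_image (a + ·) ((t - a) * ·),
      image_mul_left_Icc (sub_nonneg.2 ht.1) zero_le_one, image_const_add_Icc]
    simp
  rw [← hlin, image_image]
  congr 1
  refine image_congr fun u hu => ?_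
  have hut : a + (t - a) * u ∈ Icc a t := hlin ▸ mem_image_of_mem _ hu
  exact (IccExtend_of_mem hac ((Icc a c).domRestrict g) (Icc_subset_Icc_right ht.2 hut)).symm

/-- A continuous curve whose reversal is self-contracted has finite length, quantitatively: its
increments are controlled by those of a continuous (and then monotone) function, namely the sum of
the running maxima of the curve in finitely many directions. -/
theorem exists_continuousOn_dist_le {E : Type*} [NormedAddCommGroup E] [InnerProductSpace ℝ E]
    [ProperSpace E] {x : ℝ → E} {a c : ℝ} (hx : ContinuousOn x (Icc a c))
    (hsc : ∀ r ∈ Icc a c, ∀ s ∈ Icc a c, ∀ t ∈ Icc a c, r ≤ s → s ≤ t →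
      dist (x s) (x r) ≤ dist (x t) (x r)) :
    ∃ G : ℝ → ℝ, ContinuousOn G (Icc a c) ∧ ∀ s ∈ Icc a c, ∀ t ∈ Icc a c, s ≤ t →
      dist (x s) (x t) ≤ 8 * (G t - G s) := by
  obtain ⟨Z, hZ⟩ := exists_finset_forall_exists_norm_le_inner E
  have hg : ∀ ζ : E, ContinuousOn (fun t => inner ℝ (-ζ) (x t)) (Icc a c) := fun ζ =>
    continuousOn_const.inner hx
  let M : E → ℝ → ℝ := fun ζ t => sSup ((fun t => inner ℝ (-ζ) (x t)) '' Icc a t)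
  have hbdd : ∀ ζ, ∀ t ∈ Icc a c, BddAbove ((fun t => inner ℝ (-ζ) (x t)) '' Icc a t) :=
    fun ζ t ht => (isCompact_Icc.image_of_continuousOn
      ((hg ζ).mono (Icc_subset_Icc_right ht.2))).bddAbove
  refine ⟨fun t => ∑ ζ ∈ Z, M ζ t, continuousOn_finsetSum _ fun ζ _ =>
    continuousOn_sSup_image_Icc (hg ζ), fun s hs t ht hst => ?_⟩
  have hmono : ∀ ζ ∈ Z, 0 ≤ M ζ t - M ζ s := fun ζ _ => sub_nonneg.2 <|
    csSup_le_csSup (hbdd ζ t ht) ((nonempty_Icc.2 hs.1).image _)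
      (image_mono (Icc_subset_Icc_right hst))
  -- By self-contractedness the vectors from `x t` to the later points make acute angles.
  have hinner : ∀ r ∈ Icc a c, ∀ r' ∈ Icc a c, r ≤ r' → r' ≤ t →
      ‖x r' - x t‖ ^ 2 ≤ 2 * inner ℝ (x r' - x t) (x r - x t) := by
    intro r hr r' hr' hrr hrt
    have h := hsc r hr r' hr' t ht hrr hrt
    rw [dist_comm (x t), dist_eq_norm, dist_eq_norm,
      show x r' - x r = (x r' - x t) - (x r - x t) by abel] at h
    have h2 := pow_le_pow_left₀ (norm_nonneg _) h 2
    rw [norm_sub_sq_real (x r' - x t)] at h2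
    linarith
  obtain ⟨ζ, hζ, hζV⟩ := hZ ((fun r => x r - x t) '' Icc a t) (by
    have key : ∀ r ∈ Icc a t, ∀ r' ∈ Icc a t, r ≤ r' →
        0 ≤ inner ℝ (x r' - x t) (x r - x t) := fun r hr r' hr' h => by
      have := hinner r ⟨hr.1, hr.2.trans ht.2⟩ r' ⟨hr'.1, hr'.2.trans ht.2⟩ h hr'.2
      linarith [sq_nonneg ‖x r' - x t‖]
    rintro _ ⟨r, hr, rfl⟩ _ ⟨r', hr', rfl⟩
    rcases le_total r r' with h | h
    · rw [real_inner_comm]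
      exact key r hr r' hr' h
    · exact key r' hr' r hr h)
  have hstep : M ζ s ≤ M ζ t - dist (x s) (x t) / 8 := by
    refine csSup_le ((nonempty_Icc.2 hs.1).image _) ?_
    rintro _ ⟨r, hr, rfl⟩
    have h1 : inner ℝ (-ζ) (x t) ≤ M ζ t :=
      le_csSup (hbdd ζ t ht) (mem_image_of_mem _ (right_mem_Icc.2 ht.1))
    have h2 := hζV _ (mem_image_of_mem _ (⟨hr.1, hr.2.trans hst⟩ : r ∈ Icc a t))
    -- `‖x r - x t‖ ≥ ‖x s - x t‖ / 2`, from the acute angle and the Cauchy-Schwarz inequality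
    have h3 : ‖x s - x t‖ ≤ 2 * ‖x r - x t‖ := by
      have h4 := hinner r ⟨hr.1, hr.2.trans hs.2⟩ s hs hr.2 hst
      have h5 := real_inner_le_norm (x s - x t) (x r - x t)
      by_contra! h
      nlinarith [norm_nonneg (x s - x t), norm_nonneg (x r - x t)]
    rw [dist_eq_norm]
    simp only [inner_neg_left, inner_sub_right] at h1 h2 ⊢
    linarith
  have hsum : M ζ t - M ζ s ≤ ∑ ζ ∈ Z, (M ζ t - M ζ s) :=
    Finset.single_le_sum (f := fun ζ => M ζ t - M ζ s) hmono hζ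
  rw [Finset.sum_sub_distrib] at hsum
  linarith

/-! ### The trajectory -/

/-- A Fejér monotone curve has its one-sided velocities in the opposite normal cones: while the
curve runs through the sets containing `y`, its distance to `y` does not increase. -/
theorem inner_hasDerivWithinAt_nonneg {E : Type*} [NormedAddCommGroup E] [InnerProductSpace ℝ E]
    {γ : ℝ → E} {v y : E} {τ σ : ℝ} (hτσ : τ < σ) (hv : HasDerivWithinAt γ v (Icc τ σ) τ)
    (hγ : AntitoneOn (fun r => dist (γ r) y) (Icc τ σ)) : 0 ≤ inner ℝ v (y - γ τ) := by
  have h1 : HasDerivWithinAt (fun r => ‖γ r - y‖ ^ 2) (2 * inner ℝ (γ τ - y) v) (Icc τ σ) τ :=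
    (hv.sub_const y).norm_sq
  have h2 : AntitoneOn (fun r => ‖γ r - y‖ ^ 2) (Icc τ σ) := fun r hr r' hr' hrr => by
    have := hγ hr hr' hrr
    simp only [dist_eq_norm] at this
    exact pow_le_pow_left₀ (norm_nonneg _) this 2
  have h3 := h2.derivWithin_nonpos (x := τ)
  rw [h1.derivWithin (uniqueDiffOn_Icc hτσ τ (left_mem_Icc.2 hτσ.le))] at h3
  rw [← neg_sub, inner_neg_right, real_inner_comm]
  linarith

theorem theorem2p5 (d : ℕ) (S : ℝ → Set (EuclideanSpace ℝ (Fin d))) (a b : ℝ)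
    (hS : IsConvexFoliation S a b) (x₀ : EuclideanSpace ℝ (Fin d)) (hx₀ : x₀ ∈ S b) :
    ∃ (L : ℝ) (γ : ℝ → EuclideanSpace ℝ (Fin d)), 0 ≤ L ∧
      IsSelfContractedOn γ (Icc 0 L) ∧ IsTrajectoryOn S a b γ 0 L ∧
      γ 0 = x₀ ∧ γ L ∈ S a := by
  have ha : a ∈ Icc a b := left_mem_Icc.2 hS.le
  by_cases hx₀a : x₀ ∈ S a
  · refine ⟨0, fun _ => x₀, le_rfl, ?_, ⟨?_, ?_, ?_⟩, rfl, hx₀a⟩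
    · intro s _ r _ r' _ _
      exact le_rfl
    · exact ((LipschitzWith.const x₀).lipschitzOnWith).absolutelyContinuousOnInterval
    · simp
    · intro τ₁ h₁ τ₂ h₂ h
      exact absurd (h.trans_le h₂.2) (not_lt.2 h₁.1)
  obtain ⟨t₀, ht₀, hxt₀⟩ := hS.exists_mem_frontier hx₀ fun h => hx₀a (interior_subset h)
  obtain ⟨x, hx0, hx⟩ := hS.exists_isFejerSelection ht₀ hxt₀
  have hsub : Icc a t₀ ⊆ Icc a b := Icc_subset_Icc_right ht₀.2
  have hmem : ∀ t ∈ Icc a t₀, x t ∈ S t := fun t ht =>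
    hS.frontier_subset (hsub ht) (hx.mem_frontier t ht)
  have hcont := hS.continuousOn_of_isFejerSelection ht₀ hx
  obtain ⟨G, hG, hGx⟩ := exists_continuousOn_dist_le hcont fun r hr s hs t ht hrs hst =>
    hx.dist_le s hs t ht hst _ (hS.mono (hsub hr) (hsub hs) hrs (hmem r hr))
  have hGmono : StrictMonoOn G (Icc a t₀) := by
    intro s hs t ht hst
    have hne : x s ≠ x t := fun h => (hx.mem_frontier t ht).2
      (h ▸ hS.subset_interior s (hsub hs) t (hsub ht) hst (hmem s hs))
    linarith [dist_pos.2 hne, hGx s hs t ht hst.le]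
  have haI : a ∈ Icc a t₀ := left_mem_Icc.2 ht₀.1
  have htI : t₀ ∈ Icc a t₀ := right_mem_Icc.2 ht₀.1
  -- `T τ` is the level reached at time `τ`, where `G` has dropped by `τ` from its initial value.
  have hsurj : ∀ τ ∈ Icc 0 (G t₀ - G a), ∃ t ∈ Icc a t₀, G t = G t₀ - τ := fun τ hτ =>
    intermediate_value_Icc ht₀.1 hG ⟨by linarith [hτ.2], by linarith [hτ.1]⟩
  choose! T hTI hGT using hsurj
  have hL : 0 ≤ G t₀ - G a := sub_nonneg.2 (hGmono.monotoneOn haI htI ht₀.1)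
  have hTanti : StrictAntiOn T (Icc 0 (G t₀ - G a)) := fun τ hτ σ hσ h =>
    (hGmono.lt_iff_lt (hTI σ hσ) (hTI τ hτ)).1 (by rw [hGT σ hσ, hGT τ hτ]; linarith)
  have hT0 : T 0 = t₀ := hGmono.injOn (hTI 0 ⟨le_rfl, hL⟩) htI (by simp [hGT 0 ⟨le_rfl, hL⟩])
  have hTL : T (G t₀ - G a) = a :=
    hGmono.injOn (hTI _ ⟨hL, le_rfl⟩) haI (by simp [hGT _ ⟨hL, le_rfl⟩])
  have hdist : ∀ τ ∈ Icc 0 (G t₀ - G a), ∀ σ ∈ Icc 0 (G t₀ - G a), τ ≤ σ → ∀ y ∈ S (T σ),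
      dist (x (T σ)) y ≤ dist (x (T τ)) y := fun τ hτ σ hσ h =>
    hx.dist_le _ (hTI σ hσ) _ (hTI τ hτ) (hTanti.antitoneOn hτ hσ h)
  have hlip : LipschitzOnWith 8 (fun τ => x (T τ)) (Icc 0 (G t₀ - G a)) := by
    have key : ∀ τ ∈ Icc 0 (G t₀ - G a), ∀ σ ∈ Icc 0 (G t₀ - G a), τ ≤ σ →
        dist (x (T τ)) (x (T σ)) ≤ 8 * dist τ σ := fun τ hτ σ hσ h => by
      have h1 := hGx _ (hTI σ hσ) _ (hTI τ hτ) (hTanti.antitoneOn hτ hσ h)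
      rw [hGT τ hτ, hGT σ hσ] at h1
      rw [dist_comm, dist_comm τ, Real.dist_eq, abs_of_nonneg (sub_nonneg.2 h)]
      linarith
    refine LipschitzOnWith.of_dist_le_mul fun τ hτ σ hσ => ?_
    rcases le_total τ σ with h | h
    · simpa using key τ hτ σ hσ h
    · rw [dist_comm, dist_comm τ]
      simpa using key σ hσ τ hτ h
  refine ⟨G t₀ - G a, fun τ => x (T τ), hL, ?_, ⟨?_, ?_, ?_⟩, by simp [hT0, hx0], ?_⟩
  · rintro s hs r ⟨hr, -⟩ r' ⟨hr', hrs⟩ hrr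
    exact hdist r hr r' hr' hrr _ (hS.mono (hsub (hTI s hs)) (hsub (hTI r' hr'))
      (hTanti.antitoneOn hr' hs hrs) (hmem _ (hTI s hs)))
  · exact LipschitzOnWith.absolutelyContinuousOnInterval (by rwa [uIcc_of_le hL])
  · have hne : ∀ᵐ τ ∂(volume.restrict (Icc 0 (G t₀ - G a))), τ ≠ G t₀ - G a :=
      ae_restrict_of_ae (Measure.ae_ne volume _)
    filter_upwards [hne, hlip.ae_differentiableWithinAt_real measurableSet_Icc,
      ae_restrict_mem measurableSet_Icc] with τ hτL hdiff hτ
    refine ⟨S (T τ), derivWithin (fun τ => x (T τ)) (Icc 0 (G t₀ - G a)) τ,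
      ⟨T τ, hsub (hTI τ hτ), rfl, hx.mem_frontier _ (hTI τ hτ)⟩, hdiff.hasDerivWithinAt, ?_⟩
    have haT : a < T τ := hTL ▸ hTanti hτ ⟨hL, le_rfl⟩ (hτ.2.lt_of_ne hτL)
    have hcl : IsClosed {y | 0 ≤ inner ℝ (derivWithin (fun τ => x (T τ)) (Icc 0 (G t₀ - G a)) τ)
        (y - x (T τ))} :=
      isClosed_le continuous_const (continuous_const.inner (continuous_id.sub continuous_const))
    intro y hy
    rw [inner_neg_left, neg_nonpos]
    refine hcl.closure_subset_iff.2 ?_ (hS.subset_closure_interior (hsub (hTI τ hτ)) haT hy)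
    intro z hz
    obtain ⟨s, hs, hzs⟩ := hS.exists_lt_mem (hsub (hTI τ hτ)) haT hz
    have hsI : s ∈ Icc a t₀ := ⟨hs.1, hs.2.le.trans (hTI τ hτ).2⟩
    -- The curve stays in sets containing `z` until the time `σ` at which it reaches level `s`.
    set σ := G t₀ - G s with hσ
    have hτσ : τ < σ := by
      have := hGmono hsI (hTI τ hτ) hs.2
      rw [hGT τ hτ] at this
      linarith
    have hσI : σ ∈ Icc 0 (G t₀ - G a) :=
      ⟨hτ.1.trans hτσ.le, sub_le_sub_left (hGmono.monotoneOn haI hsI hs.1) _⟩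
    have hTσ : T σ = s := hGmono.injOn (hTI σ hσI) hsI (by rw [hGT σ hσI, hσ]; ring)
    have hIcc : Icc τ σ ⊆ Icc 0 (G t₀ - G a) := Icc_subset_Icc hτ.1 hσI.2
    refine inner_hasDerivWithinAt_nonneg (γ := fun τ => x (T τ)) hτσ
      (hdiff.hasDerivWithinAt.mono hIcc) ?_
    intro r hr r' hr' hrr
    refine hdist r (hIcc hr) r' (hIcc hr') hrr z
      (hS.mono (hsub hsI) (hsub (hTI r' (hIcc hr'))) ?_ hzs)
    rw [← hTσ]
    exact hTanti.antitoneOn (hIcc hr') hσI hr'.2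
  · intro τ₁ h₁ τ₂ h₂ h
    exact ⟨S (T τ₁), ⟨T τ₁, hsub (hTI τ₁ h₁), rfl, hx.mem_frontier _ (hTI τ₁ h₁)⟩,
      hS.subset_interior _ (hsub (hTI τ₂ h₂)) _ (hsub (hTI τ₁ h₁)) (hTanti h₁ h₂ h)
        (hmem _ (hTI τ₂ h₂))⟩
  · simpa [hTL] using hmem a haI
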